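/- Let $q_1,q_2,\ldots\in(0,1)$ and let $(w_{ij})_{i,j\ge 1}$ be independent random variables with the geometric distributions $\mathrm{Prob}(w_{ij}=k)=(1-q_j)\,q_j^{k}$ for $k=0,1,2,\ldots$. For $m,n\ge 1$ let $$G(m,n)=\max_{\Pi}\sum_{(i,j)\in\Pi}w_{ij},$$ where $\Pi$ runs over the directed lattice paths from $(1,1)$ to $(m,n)$, that is, the paths with steps $(i,j)\to(i+1,j)$ and $(i,j)\to(i,j+1)$ only. Let $m,n\ge 1$, let $\lambda=(\lambda_1\ge\cdots\ge\lambda_m\ge 0)$ be a partition with at most $m$ parts, and let $\lambda'$ be its conjugate, $\lambda'_i=|\{k:\lambda_k\ge i\}|$. Then $$\mathrm{Prob}\big(G(m,n)=\lambda_1,\,G(m-1,n)=\lambda_2,\ldots,G(1,n)=\lambda_m\big)=\prod_{i=1}^{n}(1-q_i)^m\;\det\big[e_{\lambda'_i-i+j}(1^{\lambda'_i-1},q_1,\ldots,q_n)\big]_{i,j=1}^{\lambda_1}$$ and $$\mathrm{Prob}\big(G(m,n)=\lambda_1,\,G(m-1,n)=\lambda_2,\ldots,G(1,n)=\lambda_m\big)=\prod_{i=1}^{n}(1-q_i)^m\;\det\big[h_{\lambda_i-i+j}(1^{i-1},q_1,\ldots,q_n)\big]_{i,j=1}^{m}.$$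 Here $e_k$ and $h_k$ are the elementary and the complete homogeneous symmetric polynomials ($e_k=h_k=0$ for $k<0$), $1^a$ stands for $a$ arguments equal to $1$, and the determinant of the $0\times 0$ matrix is $1$. -/

import Mathlib

open MeasureTheory ProbabilityTheory

namespace Percolation

/-- One step `(i, j) → (i + 1, j)` or `(i, j) → (i, j + 1)` of a directed path. -/
def Step (a b : ℕ × ℕ) : Prop :=
  b = (a.1 + 1, a.2) ∨ b = (a.1, a.2 + 1)

/-- `l` is the list of successive vertices of a directed path from `a` to `b`. -/
def IsDirectedPath (a b : ℕ × ℕ) (l : List (ℕ × ℕ)) : Prop :=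
  l.IsChain Step ∧ l.head? = some a ∧ l.getLast? = some b

/-- The sums `∑_{(i,j) ∈ Π} w i j`, where `Π` runs over the directed paths from `(1, 1)` to
`(m, n)`. -/
def pathWeights (w : ℕ → ℕ → ℕ) (m n : ℕ) : Set ℕ :=
  {s | ∃ l : List (ℕ × ℕ), IsDirectedPath (1, 1) (m, n) l ∧ s = (l.map fun p => w p.1 p.2).sum}

/-- The last-passage time `G(m, n)` of the weights `w i j`, `i, j ≥ 1`: the maximum of the weights
of the directed paths from `(1, 1)` to `(m, n)`. For `m, n ≥ 1` the supremum is attained, see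
`isGreatest_lastPassage`. -/
noncomputable def lastPassage (w : ℕ → ℕ → ℕ) (m n : ℕ) : ℕ :=
  sSup (pathWeights w m n)

theorem pathWeights_nonempty (w : ℕ → ℕ → ℕ) {m n : ℕ} (hm : 1 ≤ m) (hn : 1 ≤ n) :
    (pathWeights w m n).Nonempty := by
  suffices h : ∃ l : List (ℕ × ℕ), IsDirectedPath (1, 1) (m, n) l by
    obtain ⟨l, hl⟩ := h
    exact ⟨_, l, hl, rfl⟩
  have snoc : ∀ (a b c : ℕ × ℕ), Step b c → (∃ l, IsDirectedPath a b l) →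
      ∃ l, IsDirectedPath a c l := by
    rintro a b c hs ⟨l, h1, h2, h3⟩
    refine ⟨l ++ [c], ?_, ?_, ?_⟩
    · refine List.isChain_append.2 ⟨h1, by simp, ?_⟩
      intro x hx y hy
      rw [h3] at hx
      simp at hx hy
      subst hx hy
      exact hs
    · simp [h2]
    · simp
  induction m, hm using Nat.le_induction with
  | base =>
    induction n, hn using Nat.le_induction with
    | base => exact ⟨[(1, 1)], by simp [IsDirectedPath]⟩
    | succ k _ ih => exact snoc _ _ _ (Or.inr rfl) ih
  | succ k _ ih => exact snoc _ _ _ (Or.inl rfl) ih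

theorem pathWeights_bddAbove (w : ℕ → ℕ → ℕ) (m n : ℕ) : BddAbove (pathWeights w m n) := by
  have key : ∀ (l : List (ℕ × ℕ)) (a b : ℕ × ℕ), IsDirectedPath a b l →
      l.Nodup ∧ ∀ p ∈ l, a ≤ p ∧ p ≤ b := by
    intro l
    induction l with
    | nil => rintro a b ⟨-, h, -⟩; simp at h
    | cons x t ih =>
      rintro a b ⟨h1, h2, h3⟩
      simp only [List.head?_cons, Option.some.injEq] at h2
      subst h2
      cases t with
      | nil => simp at h3; subst h3; simp
      | cons y u =>
        obtain ⟨hs, hc⟩ := List.isChain_cons_cons.1 h1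
        have hlt : x < y := by
          rcases hs with h | h <;> rw [h] <;> refine Prod.lt_iff.2 ?_ <;> simp
        obtain ⟨g1, g2⟩ := ih y b ⟨hc, by simp, by simpa using h3⟩
        refine ⟨List.nodup_cons.2 ⟨fun hx => ?_, g1⟩, ?_⟩
        · exact absurd (g2 x hx).1 (not_le_of_gt hlt)
        · intro p hp
          rcases List.mem_cons.1 hp with rfl | hp
          · exact ⟨le_rfl, hlt.le.trans (g2 y (by simp)).2⟩
          · exact ⟨hlt.le.trans (g2 p hp).1, (g2 p hp).2⟩
  refine ⟨∑ p ∈ Finset.Icc ((1, 1) : ℕ × ℕ) (m, n), w p.1 p.2, ?_⟩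
  rintro s ⟨l, hl, rfl⟩
  obtain ⟨g1, g2⟩ := key l _ _ hl
  rw [← List.sum_toFinset (fun p : ℕ × ℕ => w p.1 p.2) g1]
  refine Finset.sum_le_sum_of_subset fun p hp => ?_
  exact Finset.mem_Icc.2 (g2 p (List.mem_toFinset.1 hp))

theorem isGreatest_lastPassage (w : ℕ → ℕ → ℕ) {m n : ℕ} (hm : 1 ≤ m) (hn : 1 ≤ n) :
    IsGreatest (pathWeights w m n) (lastPassage w m n) :=
  ⟨Nat.sSup_mem (pathWeights_nonempty w hm hn) (pathWeights_bddAbove w m n),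
    fun _ hs => le_csSup (pathWeights_bddAbove w m n) hs⟩

/-- The conjugate of the partition `lam 0 ≥ lam 1 ≥ ⋯ ≥ lam (m - 1)`; its parts, like those of
`lam`, are numbered from `0`, so that `conjPart lam i` is the `(i + 1)`-st part. -/
def conjPart {m : ℕ} (lam : Fin m → ℕ) (i : ℕ) : ℕ :=
  (Finset.univ.filter fun k : Fin m => i < lam k).card

/-- The variables `(1^a, q_1, …, q_n)`. -/
def onesAppend (a n : ℕ) (q : ℕ → ℝ) : Fin a ⊕ Fin n → ℝ :=
  Sum.elim (fun _ => 1) (fun i => q (i + 1))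

/-- `e_k(1^a, q_1, …, q_n)`, with `e_k = 0` for `k < 0`. -/
noncomputable def elemSymm (k : ℤ) (a n : ℕ) (q : ℕ → ℝ) : ℝ :=
  if 0 ≤ k then
    MvPolynomial.eval (onesAppend a n q) (MvPolynomial.esymm (Fin a ⊕ Fin n) ℝ k.toNat)
  else 0

/-- `h_k(1^a, q_1, …, q_n)`, with `h_k = 0` for `k < 0`. -/
noncomputable def complSymm (k : ℤ) (a n : ℕ) (q : ℕ → ℝ) : ℝ :=
  if 0 ≤ k then
    MvPolynomial.eval (onesAppend a n q) (MvPolynomial.hsymm (Fin a ⊕ Fin n) ℝ k.toNat)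
  else 0

end Percolation

/-!
The vector `x = (G(m, n), …, G(1, n))` is a Markov chain in `n`. By the recursion
`G(i, n + 1) = max (G(i, n)) (G(i - 1, n + 1)) + w_{i, n + 1}` (`lastPassage_succ_succ`), the
transition from `x` to `y` has, with `p = q_{n + 1}`, the probability
`(1 - p)^m * ∏ i, p ^ (y_i - max (x_i) (y_{i + 1}))` (`measureReal_lastPassage_succ`). The formula
with complete homogeneous symmetric polynomials follows by induction on `n`, once the determinants
`det h_{x_i - i + j}(1^{i - 1}, q_1, …, q_n)` are known to solve the same evolution equation
(`sum_antitone_mul_det_complSymm`). For this, sum the determinant over the parts of `x`, starting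
with the largest one. Since `h_k(1^{r + 1}, …) - h_{k - 1}(1^{r + 1}, …) = h_k(1^r, …)`, the sum of
row `i` over `x_{i + 1} ≤ x_i ≤ y_{i + 1}` telescopes, and its lower end is row `i + 1`, which does
not contribute to the determinant; the sum over `y_{i + 1} < x_i ≤ y_i` with the weights
`p ^ (y_i - x_i)` adjoins the variable `p`. The resulting rows are those of the new determinant, up to
multiples of the next row.

The formula with elementary symmetric polynomials is then an algebraic identity
(`det_complSymm_eq_det_elemSymm`). Encode the partition by a sequence of particles (rows) and holes
(columns). There are mutually inverse unitriangular matrices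
(`complSymm_matrix_mul_elemSymm_matrix`) such that the particle rows of the first give the
determinant in the `h_k` and the hole columns of the second the determinant in the `e_k`. These are
complementary minors of a matrix and its inverse, hence agree up to a sign
(`det_toBlocks₁₁_of_mul_eq_one`), and the sign of the particle-hole permutation
(`sign_particle_hole_perm`) cancels the signs of the entries of the inverse.
-/

namespace Percolation

/-! ### Generating functions -/

section GeneratingFunctions

open PowerSeries

theorem eval_hsymm {σ : Type*} [Fintype σ] [DecidableEq σ] (x : σ → ℝ) (k : ℕ) :
    MvPolynomial.eval x (MvPolynomial.hsymm σ ℝ k) =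
      ∑ s : Sym σ k, ((s : Multiset σ).map x).prod := by
  simp only [MvPolynomial.hsymm, map_sum]
  refine Finset.sum_congr rfl fun s _ => ?_
  rw [map_multiset_prod, Multiset.map_map]
  simp

/-- The complete homogeneous symmetric polynomials of `x` have the generating function
`∏ i, (1 - x i * t)⁻¹`. The variables are adjoined one at a time: a multiset with elements in
`Option σ` either contains `none` or comes from a multiset with elements in `σ`. -/
theorem mk_eval_hsymm_mul_prod {σ : Type*} [Fintype σ] [DecidableEq σ] (x : σ → ℝ) :
    (PowerSeries.mk fun k => MvPolynomial.eval x (MvPolynomial.hsymm σ ℝ k)) *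
      ∏ i, (1 - C (x i) * X) = 1 := by
  classical
  have key : ∀ [DecidableEq σ] (y : σ → ℝ),
      (PowerSeries.mk fun k => ∑ s : Sym σ k, ((s : Multiset σ).map y).prod) *
        ∏ i, (1 - C (y i) * X) = 1 := by
    refine Fintype.induction_empty_option (P := fun τ _ => ∀ [DecidableEq τ] (y : τ → ℝ),
      (PowerSeries.mk fun k => ∑ s : Sym τ k, ((s : Multiset τ).map y).prod) *
        ∏ i, (1 - C (y i) * X) = 1) ?_ ?_ ?_ σ
    · intro α β _ e ih _ y
      let _ := Fintype.ofEquiv β e.symm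
      let _ : DecidableEq α := Classical.decEq α
      refine Eq.trans ?_ (ih (y ∘ e))
      congr 1
      · ext k
        simp only [coeff_mk]
        refine (Fintype.sum_equiv (Sym.equivCongr e) _ _ fun s => ?_).symm
        simp [Sym.equivCongr, Multiset.map_map]
      · exact (Fintype.prod_equiv e (fun i => 1 - C ((y ∘ e) i) * X) (fun i => 1 - C (y i) * X)
          fun i => rfl).symm
    · intro _ y
      ext k
      cases k <;> simp [PowerSeries.coeff_one, Sym.eq_nil_of_card_zero]
    · intro α _ ih _ y
      let _ : DecidableEq α := Classical.decEq α
      have hopt : (PowerSeries.mk fun k => ∑ s : Sym (Option α) k,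
            ((s : Multiset (Option α)).map y).prod) * (1 - C (y none) * X) =
          PowerSeries.mk fun k =>
            ∑ s : Sym α k, ((s : Multiset α).map fun a => y (some a)).prod := by
        ext k
        cases k with
        | zero => simp [mul_sub, Sym.eq_nil_of_card_zero]
        | succ k =>
          rw [mul_sub, mul_one, ← mul_assoc, map_sub, PowerSeries.coeff_succ_mul_X,
            mul_comm _ (C _), PowerSeries.coeff_C_mul]
          simp only [coeff_mk]
          rw [← Fintype.sum_equiv (symOptionSuccEquiv (α := α) (n := k)).symm
            (fun s => ((symOptionSuccEquiv.symm s : Multiset (Option α)).map y).prod) _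
            fun s => rfl, Fintype.sum_sum_type, Finset.mul_sum]
          have hcons (s : Sym (Option α) k) :
              (((none ::ₛ s : Sym (Option α) (k + 1)) : Multiset (Option α)).map y).prod =
                y none * ((s : Multiset (Option α)).map y).prod := by
            rw [show ((none ::ₛ s : Sym (Option α) (k + 1)) : Multiset (Option α)) =
              none ::ₘ (s : Multiset (Option α)) from rfl, Multiset.map_cons, Multiset.prod_cons]
          simp [symOptionSuccEquiv, Multiset.map_map, hcons]
      rw [Fintype.prod_option, ← mul_assoc, hopt]
      exact ih fun a => y (some a)
  simp only [eval_hsymm]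
  exact key x

/-- The elementary symmetric polynomials of `x` have the generating function
`∏ i, (1 + x i * t)`; here `t` is replaced by `-t`. -/
theorem coeff_prod_one_sub {σ : Type*} [Fintype σ] (x : σ → ℝ) (k : ℕ) :
    coeff k (∏ i, (1 - C (x i) * X)) =
      (-1) ^ k * MvPolynomial.eval x (MvPolynomial.esymm σ ℝ k) := by
  classical
  simp only [sub_eq_add_neg, Finset.prod_one_add, map_sum, MvPolynomial.esymm, map_prod,
    MvPolynomial.eval_X]
  rw [Finset.mul_sum, Finset.powersetCard_eq_filter, Finset.sum_filter]
  refine Finset.sum_congr rfl fun s _ => ?_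
  have : ∏ i ∈ s, -(C (x i) * X) = C ((-1) ^ s.card * ∏ i ∈ s, x i) * X ^ s.card := by
    rw [Finset.prod_neg, Finset.prod_mul_distrib, Finset.prod_const]
    simp [mul_assoc]
  rw [this, coeff_C_mul, coeff_X_pow]
  by_cases h : s.card = k
  · simp [h]
  · simp [h, Ne.symm h]

/-- The polynomial `(1 - t)^a * ∏ i, (1 - q_i * t)`, `1 ≤ i ≤ n`, whose coefficients are up to sign
the `e_k(1^a, q_1, …, q_n)`, and whose inverse has the coefficients `h_k(1^a, q_1, …, q_n)`. -/
noncomputable def denom (a n : ℕ) (q : ℕ → ℝ) : ℝ⟦X⟧ :=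
  (1 - X) ^ a * ∏ i ∈ Finset.range n, (1 - C (q (i + 1)) * X)

theorem prod_onesAppend (a n : ℕ) (q : ℕ → ℝ) :
    ∏ i, (1 - C (onesAppend a n q i) * X) = denom a n q := by
  rw [Fintype.prod_sum_type, denom, ← Fin.prod_univ_eq_prod_range (fun i => 1 - C (q (i + 1)) * X)]
  simp [onesAppend]

theorem constantCoeff_denom (a n : ℕ) (q : ℕ → ℝ) : constantCoeff (denom a n q) = 1 := by
  simp [denom, map_prod]

theorem denom_succ_left (a n : ℕ) (q : ℕ → ℝ) : denom (a + 1) n q = (1 - X) * denom a n q := by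
  simp only [denom]; ring

theorem denom_succ_right (a n : ℕ) (q : ℕ → ℝ) :
    denom a (n + 1) q = (1 - C (q (n + 1)) * X) * denom a n q := by
  simp only [denom, Finset.prod_range_succ]; ring

theorem denom_mul_inv (a n : ℕ) (q : ℕ → ℝ) : denom a n q * (denom a n q)⁻¹ = 1 :=
  PowerSeries.mul_inv_cancel _ (by rw [constantCoeff_denom]; exact one_ne_zero)

/-- The coefficient of `t^z` for an integer `z`, zero if `z < 0`. -/
noncomputable def intCoeff (f : ℝ⟦X⟧) (z : ℤ) : ℝ :=
  if 0 ≤ z then coeff z.toNat f else 0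

theorem intCoeff_sub (f g : ℝ⟦X⟧) (z : ℤ) : intCoeff (f - g) z = intCoeff f z - intCoeff g z := by
  unfold intCoeff; split_ifs <;> simp

theorem intCoeff_C_mul (c : ℝ) (f : ℝ⟦X⟧) (z : ℤ) : intCoeff (C c * f) z = c * intCoeff f z := by
  unfold intCoeff; split_ifs <;> simp

theorem intCoeff_X_mul (f : ℝ⟦X⟧) (z : ℤ) : intCoeff (X * f) z = intCoeff f (z - 1) := by
  unfold intCoeff
  rcases lt_trichotomy z 0 with h | rfl | h
  · rw [if_neg (by omega), if_neg (by omega)]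
  · simp
  · obtain ⟨k, rfl⟩ : ∃ k : ℕ, z = (k : ℤ) + 1 := ⟨(z - 1).toNat, by omega⟩
    rw [if_pos (by omega), if_pos (by omega)]
    have h1 : ((k : ℤ) + 1).toNat = k + 1 := by omega
    have h2 : ((k : ℤ) + 1 - 1).toNat = k := by omega
    rw [h1, h2, coeff_succ_X_mul]

theorem complSymm_eq_intCoeff (z : ℤ) (a n : ℕ) (q : ℕ → ℝ) :
    complSymm z a n q = intCoeff (denom a n q)⁻¹ z := by
  have h := mk_eval_hsymm_mul_prod (onesAppend a n q)
  rw [prod_onesAppend] at h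
  have h2 : (denom a n q)⁻¹ =
      PowerSeries.mk fun k => MvPolynomial.eval (onesAppend a n q) (MvPolynomial.hsymm _ ℝ k) := by
    rw [PowerSeries.inv_eq_iff_mul_eq_one (by rw [constantCoeff_denom]; exact one_ne_zero)]
    exact h
  rw [h2]
  simp [complSymm, intCoeff]

theorem elemSymm_eq_intCoeff (z : ℤ) (a n : ℕ) (q : ℕ → ℝ) :
    elemSymm z a n q = (-1) ^ z.toNat * intCoeff (denom a n q) z := by
  unfold elemSymm intCoeff
  split_ifs
  · rw [← prod_onesAppend, coeff_prod_one_sub, ← mul_assoc, ← mul_pow]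
    simp
  · simp

theorem complSymm_of_neg {z : ℤ} (hz : z < 0) (a n : ℕ) (q : ℕ → ℝ) : complSymm z a n q = 0 :=
  if_neg (by omega)

theorem complSymm_zero (a n : ℕ) (q : ℕ → ℝ) : complSymm 0 a n q = 1 := by
  simp [complSymm]

theorem complSymm_no_vars (z : ℤ) (hz : z ≠ 0) (q : ℕ → ℝ) : complSymm z 0 0 q = 0 := by
  have h : (denom 0 0 q)⁻¹ = 1 := by simp [denom]
  rw [complSymm_eq_intCoeff, h, intCoeff]
  split_ifs with h0
  · rw [coeff_one, if_neg (by omega)]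
  · rfl

theorem inv_denom_succ_left (a n : ℕ) (q : ℕ → ℝ) :
    (denom a n q)⁻¹ = (1 - X) * (denom (a + 1) n q)⁻¹ := by
  rw [PowerSeries.inv_eq_iff_mul_eq_one (by rw [constantCoeff_denom]; exact one_ne_zero),
    mul_right_comm, ← denom_succ_left, denom_mul_inv]

theorem inv_denom_succ_right (a n : ℕ) (q : ℕ → ℝ) :
    (denom a n q)⁻¹ = (1 - C (q (n + 1)) * X) * (denom a (n + 1) q)⁻¹ := by
  rw [PowerSeries.inv_eq_iff_mul_eq_one (by rw [constantCoeff_denom]; exact one_ne_zero),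
    mul_right_comm, ← denom_succ_right, denom_mul_inv]

theorem complSymm_sub_complSymm_pred (z : ℤ) (a n : ℕ) (q : ℕ → ℝ) :
    complSymm z (a + 1) n q - complSymm (z - 1) (a + 1) n q = complSymm z a n q := by
  simp only [complSymm_eq_intCoeff]
  rw [inv_denom_succ_left a n, sub_mul, one_mul, intCoeff_sub, intCoeff_X_mul]

theorem complSymm_sub_mul_complSymm_pred (z : ℤ) (a n : ℕ) (q : ℕ → ℝ) :
    complSymm z a (n + 1) q - q (n + 1) * complSymm (z - 1) a (n + 1) q = complSymm z a n q := by
  simp only [complSymm_eq_intCoeff]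
  rw [inv_denom_succ_right a n, sub_mul, one_mul, intCoeff_sub, mul_assoc, intCoeff_C_mul,
    intCoeff_X_mul]

end GeneratingFunctions

/-! ### Summing determinants over partitions -/

theorem sum_piFinset_succ {m : ℕ} (y : ℕ → ℕ) (g : (Fin (m + 1) → ℕ) → ℝ) :
    ∑ x ∈ Fintype.piFinset fun i : Fin (m + 1) => Finset.Icc 0 (y i), g x =
      ∑ x ∈ Fintype.piFinset fun i : Fin m => Finset.Icc 0 (y (i + 1)),
        ∑ a ∈ Finset.Icc 0 (y 0), g (Fin.cons a x) := by
  rw [Finset.sum_sigma']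
  refine (Finset.sum_bij' (fun p _ => Fin.cons p.2 p.1) (fun x _ => ⟨Fin.tail x, x 0⟩)
    ?_ ?_ ?_ ?_ ?_).symm
  · intro p hp
    simp only [Finset.mem_sigma, Fintype.mem_piFinset, Finset.mem_Icc, zero_le, true_and] at hp ⊢
    exact Fin.cases hp.2 fun i => by simpa using hp.1 i
  · intro x hx
    simp only [Finset.mem_sigma, Fintype.mem_piFinset, Finset.mem_Icc, zero_le, true_and] at hx ⊢
    exact ⟨fun i => by simpa [Fin.tail] using hx i.succ, by simpa using hx 0⟩
  · intro p _; simp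
  · intro x _; simp
  · intro p _; rfl

theorem antitone_cons {m : ℕ} (a : ℕ) (x : Fin (m + 1) → ℕ) :
    Antitone (Fin.cons a x : Fin (m + 2) → ℕ) ↔ x 0 ≤ a ∧ Antitone x := by
  rw [Fin.antitone_iff_succ_le, Fin.antitone_iff_succ_le]
  constructor
  · intro h
    exact ⟨by simpa using h 0, fun i => by simpa using h i.succ⟩
  · rintro ⟨h0, h⟩
    refine Fin.cases (by simpa using h0) fun i => ?_
    simpa using h i

theorem curryLeft_sum_apply {V ι : Type*} [AddCommGroup V] [Module ℝ V] {m : ℕ}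
    (f : V [⋀^Fin (m + 1)]→ₗ[ℝ] ℝ) (s : Finset ι) (g : ι → V) (v : Fin m → V) :
    f.curryLeft (∑ x ∈ s, g x) v = ∑ x ∈ s, f.curryLeft (g x) v := by
  classical
  induction s using Finset.induction_on with
  | empty => simp
  | insert a s ha ih =>
    rw [Finset.sum_insert ha, Finset.sum_insert ha, map_add, AlternatingMap.add_apply, ih]

/-- Summation over the partitions `x 0 ≥ x 1 ≥ ⋯` inside the box `x i ≤ y i` commutes with an
alternating map `f`, although the ranges of the `x i` are not independent: the largest part `x 0` is
summed first, over `x 1 ≤ x 0 ≤ y 0`, and the contribution of the lower end of this range is a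
multiple of the next argument of `f`, hence is killed by `f`. The multiples `c i • τ (i + 1)` vanish
for the same reason. -/
theorem sum_antitone_mul_alternatingMap {V : Type*} [AddCommGroup V] [Module ℝ V] (m : ℕ) :
    ∀ (f : V [⋀^Fin m]→ₗ[ℝ] ℝ) (φ : ℕ → ℕ → V) (w : ℕ → ℕ → ℝ) (y : ℕ → ℕ) (τ : ℕ → V)
      (c d : ℕ → ℝ),
      (∀ i, i + 1 < m → ∀ a ≤ y (i + 1), ∑ x ∈ Finset.Icc a (y i), w i x • φ i x =
        τ i + c i • τ (i + 1) + d i • φ (i + 1) a) →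
      (∀ i, i + 1 = m → ∑ x ∈ Finset.Icc 0 (y i), w i x • φ i x = τ i) →
      Antitone y →
      (∑ x ∈ (Fintype.piFinset fun i : Fin m => Finset.Icc 0 (y i)) with Antitone x,
        (∏ i : Fin m, w i (x i)) * f fun i => φ i (x i)) = f fun i => τ i := by
  induction m with
  | zero =>
    intro f φ w y τ c d _ _ _
    rw [Finset.sum_filter]
    simp [Subsingleton.antitone, Subsingleton.elim (fun i : Fin 0 => φ i _) fun i => τ i]
  | succ m ih =>
    intro f φ w y τ c d hstep hlast hy
    have hf (a : ℕ) (x : Fin m → ℕ) :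
        (f fun i : Fin (m + 1) => φ i ((Fin.cons a x : Fin (m + 1) → ℕ) i)) =
          f.curryLeft (φ 0 a) fun i => φ (i + 1) (x i) := by
      rw [AlternatingMap.curryLeft_apply_apply]
      congr 1
      ext i
      refine Fin.cases ?_ (fun i => ?_) i <;> simp
    have hτ : (f fun i : Fin (m + 1) => τ i) = f.curryLeft (τ 0) fun i : Fin m => τ (i + 1) := by
      rw [AlternatingMap.curryLeft_apply_apply]
      congr 1
      ext i
      refine Fin.cases ?_ (fun i => ?_) i <;> simp
    rw [Finset.sum_filter, sum_piFinset_succ, hτ]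
    simp only [Fin.prod_univ_succ, hf]
    rcases m with _ | m
    · have hanti (x : Fin (0 + 1) → ℕ) : Antitone x := fun i j _ => by
        rw [show i = j from Fin.ext (by omega)]
      rw [← hlast 0 rfl, curryLeft_sum_apply]
      simp only [hanti, if_true, Fintype.piFinset_of_isEmpty, Finset.univ_unique,
        Finset.sum_singleton]
      refine Finset.sum_congr rfl fun a _ => ?_
      rw [map_smul, AlternatingMap.smul_apply, smul_eq_mul]
      simp [Subsingleton.elim (fun i : Fin 0 => φ (i + 1) _) fun i => τ (i + 1)]
    · have hc : f.curryLeft (τ 0) (fun i : Fin (m + 1) => τ (i + 1)) =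
          f.curryLeft (τ 0 + c 0 • τ 1) fun i : Fin (m + 1) => τ (i + 1) := by
        have h0 : f.curryLeft (τ 1) (fun i : Fin (m + 1) => τ (i + 1)) = 0 := by
          rw [AlternatingMap.curryLeft_apply_apply]
          exact f.map_eq_zero_of_eq _ (i := 0) (j := 1) (by simp) (by simp)
        simp [h0]
      rw [hc, ← ih (f.curryLeft (τ 0 + c 0 • τ 1)) (fun i => φ (i + 1)) (fun i => w (i + 1))
        (fun i => y (i + 1)) (fun i => τ (i + 1)) (fun i => c (i + 1)) (fun i => d (i + 1))
        (fun i hi => hstep (i + 1) (by omega)) (fun i hi => hlast (i + 1) (by omega))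
        (fun i j hij => hy (by omega)), Finset.sum_filter]
      refine Finset.sum_congr rfl fun x hx => ?_
      simp only [antitone_cons]
      by_cases hx' : Antitone x
      · have hx0 : x 0 ≤ y 1 := by
          have := Fintype.mem_piFinset.1 hx 0
          simpa using this
        have h0 : f.curryLeft (φ 1 (x 0)) (fun i : Fin (m + 1) => φ (i + 1) (x i)) = 0 := by
          rw [AlternatingMap.curryLeft_apply_apply]
          exact f.map_eq_zero_of_eq _ (i := 0) (j := 1) (by simp) (by simp)
        have hsum := congrArg (fun v => f.curryLeft v fun i : Fin (m + 1) => φ (i + 1) (x i))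
          (hstep 0 (by omega) (x 0) hx0)
        simp only [curryLeft_sum_apply, map_add, map_smul, AlternatingMap.add_apply,
          AlternatingMap.smul_apply, zero_add, h0, smul_zero, add_zero] at hsum
        simp only [hx', and_true, if_true, map_add, map_smul, AlternatingMap.add_apply,
          AlternatingMap.smul_apply]
        rw [← hsum, Finset.mul_sum, ← Finset.sum_filter]
        have hIcc : (Finset.Icc 0 (y 0)).filter (fun a => x 0 ≤ a) = Finset.Icc (x 0) (y 0) := by
          ext a; simp [and_comm]
        rw [hIcc]
        refine Finset.sum_congr rfl fun a _ => ?_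
        simp
        ring
      · simp [hx']

theorem sum_Icc_complSymm {a b : ℕ} (hab : a ≤ b) (s : ℤ) (r n : ℕ) (q : ℕ → ℝ) :
    ∑ x ∈ Finset.Icc a b, complSymm (x + s) r n q =
      complSymm (b + s) (r + 1) n q - complSymm (a - 1 + s) (r + 1) n q := by
  induction b, hab using Nat.le_induction with
  | base =>
    rw [Finset.Icc_self, Finset.sum_singleton, ← complSymm_sub_complSymm_pred]
    congr 2; ring
  | succ b hb ih =>
    rw [Finset.sum_Icc_succ_top (by omega), ih,
      ← complSymm_sub_complSymm_pred ((b + 1 : ℕ) + s) r]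
    push_cast
    rw [show ((b : ℤ) + 1 + s - 1) = b + s by ring]
    ring

/-- The sum over one part `x` of the transition weight `p ^ (Y - max x b)`, `p = q (n + 1)`, times
a row entry. The range splits into `x ≤ b`, where the weight is constant and the sum telescopes, and
`b < x ≤ Y`, where the weight completes `h(1^r, q_1, …, q_n)` to `h(1^r, q_1, …, q_{n+1})`. -/
theorem sum_Icc_pow_mul_complSymm {a b Y : ℕ} (hab : a ≤ b) (hbY : b ≤ Y) (s : ℤ) (r n : ℕ)
    (q : ℕ → ℝ) :
    ∑ x ∈ Finset.Icc a Y, q (n + 1) ^ (Y - max x b) * complSymm (x + s) r n q =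
      complSymm (Y + s) r (n + 1) q +
        q (n + 1) ^ (Y - b) * (1 - q (n + 1)) * complSymm (b - 1 + s) (r + 1) (n + 1) q -
        q (n + 1) ^ (Y - b) * complSymm (a - 1 + s) (r + 1) n q := by
  induction Y, hbY using Nat.le_induction with
  | base =>
    have h : ∀ x ∈ Finset.Icc a b, q (n + 1) ^ (b - max x b) * complSymm (x + s) r n q =
        complSymm (x + s) r n q := fun x hx => by
      rw [max_eq_right (Finset.mem_Icc.1 hx).2]; simp
    rw [Finset.sum_congr rfl h, sum_Icc_complSymm hab, ← complSymm_sub_mul_complSymm_pred (b + s),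
      ← complSymm_sub_complSymm_pred (b + s) r (n + 1), show (b : ℤ) + s - 1 = b - 1 + s by ring]
    simp
    ring
  | succ Y hY ih =>
    have h : ∀ x ∈ Finset.Icc a Y, q (n + 1) ^ (Y + 1 - max x b) * complSymm (x + s) r n q =
        q (n + 1) * (q (n + 1) ^ (Y - max x b) * complSymm (x + s) r n q) := fun x hx => by
      have := (Finset.mem_Icc.1 hx).2
      rw [Nat.sub_add_comm (max_le this hY), pow_succ]
      ring
    rw [Finset.sum_Icc_succ_top (by omega), Finset.sum_congr rfl h, ← Finset.mul_sum, ih,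
      max_eq_left (by omega), Nat.sub_self, pow_zero, one_mul, Nat.sub_add_comm hY, pow_succ,
      ← complSymm_sub_mul_complSymm_pred ((Y + 1 : ℕ) + s)]
    push_cast
    rw [show ((Y : ℤ) + 1 + s - 1) = Y + s by ring]
    ring

/-- The determinants `det h_{λ_i - i + j}(1^{i-1}, q_1, …, q_n)` satisfy the evolution equation of
the last-passage times: the weight of the transition `x → y` when the column `n + 1` is added is,
up to normalisation, `∏ i, q (n + 1) ^ (y i - max (x i) (y (i + 1)))`. -/
theorem sum_antitone_mul_det_complSymm (m n : ℕ) (q : ℕ → ℝ) (y : ℕ → ℕ) (hy : Antitone y)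
    (hym : y m = 0) :
    ∑ x ∈ (Fintype.piFinset fun i : Fin m => Finset.Icc 0 (y i)) with Antitone x,
      (∏ i : Fin m, q (n + 1) ^ (y i - max (x i) (y (i + 1)))) *
        (Matrix.of fun i j : Fin m => complSymm ((x i : ℤ) - (i : ℕ) + (j : ℕ)) i n q).det =
      (Matrix.of fun i j : Fin m =>
        complSymm ((y i : ℤ) - (i : ℕ) + (j : ℕ)) i (n + 1) q).det := by
  refine sum_antitone_mul_alternatingMap m (Matrix.detRowAlternating (n := Fin m) (R := ℝ))
    (fun i x j => complSymm ((x : ℤ) - (i : ℕ) + (j : ℕ)) i n q)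
    (fun i x => q (n + 1) ^ (y i - max x (y (i + 1)))) y
    (fun i j => complSymm ((y i : ℤ) - (i : ℕ) + (j : ℕ)) i (n + 1) q)
    (fun i => q (n + 1) ^ (y i - y (i + 1)) * (1 - q (n + 1)))
    (fun i => -q (n + 1) ^ (y i - y (i + 1))) ?_ ?_ hy
  · intro i hi a ha
    ext j
    have h := sum_Icc_pow_mul_complSymm ha (hy (Nat.le_succ i)) (-(i : ℤ) + (j : ℕ)) i n q
    simp only [Finset.sum_apply, Pi.smul_apply, Pi.add_apply, smul_eq_mul]
    push_cast
    rw [show ((y (i + 1) : ℤ) - (i + 1) + (j : ℕ)) = y (i + 1) - 1 + (-i + (j : ℕ)) by ring,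
      show ((a : ℤ) - (i + 1) + (j : ℕ)) = a - 1 + (-i + (j : ℕ)) by ring]
    refine Eq.trans (Finset.sum_congr rfl fun x _ => ?_) (h.trans ?_)
    · rw [show ((x : ℤ) - i + (j : ℕ)) = x + (-i + (j : ℕ)) by ring]
    · rw [show ((y i : ℤ) - i + (j : ℕ)) = y i + (-i + (j : ℕ)) by ring]
      ring
  · intro i hi
    ext j
    have h := sum_Icc_pow_mul_complSymm (a := 0) le_rfl (Nat.zero_le (y i))
      (-(i : ℤ) + (j : ℕ)) i n q
    -- In the last row `i = m - 1` the two boundary terms have negative degree.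
    have hneg : ((0 : ℕ) : ℤ) - 1 + (-(i : ℤ) + (j : ℕ)) < 0 := by omega
    rw [complSymm_of_neg hneg, complSymm_of_neg hneg] at h
    simp only [Finset.sum_apply, Pi.smul_apply, smul_eq_mul]
    subst hi
    rw [hym]
    refine Eq.trans (Finset.sum_congr rfl fun x _ => ?_) (h.trans ?_)
    · rw [show ((x : ℤ) - i + (j : ℕ)) = x + (-i + (j : ℕ)) by ring]
    · rw [show ((y i : ℤ) - i + (j : ℕ)) = y i + (-i + (j : ℕ)) by ring]
      ring

/-! ### The recursion for the last-passage times -/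

theorem isDirectedPath_iff {a b : ℕ × ℕ} {l : List (ℕ × ℕ)} :
    IsDirectedPath a b l ↔
      (a = b ∧ l = [b]) ∨ ∃ c l', Step c b ∧ IsDirectedPath a c l' ∧ l = l' ++ [b] := by
  constructor
  · rintro ⟨h1, h2, h3⟩
    rcases List.eq_nil_or_concat' l with rfl | ⟨l', x, rfl⟩
    · simp at h2
    obtain rfl : x = b := by simpa using h3
    rcases List.eq_nil_or_concat' l' with rfl | ⟨l'', c, rfl⟩
    · left; simpa [eq_comm] using h2
    · right
      obtain ⟨g1, -, g3⟩ := List.isChain_append.1 h1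
      refine ⟨c, _, g3 c (by simp) x (by simp), ⟨g1, ?_, by simp⟩, rfl⟩
      rw [List.head?_append_of_ne_nil _ (by simp)] at h2
      exact h2
  · rintro (⟨rfl, rfl⟩ | ⟨c, l', hs, ⟨h1, h2, h3⟩, rfl⟩)
    · simp [IsDirectedPath]
    · refine ⟨List.isChain_append.2 ⟨h1, by simp, ?_⟩, by simp [h2], by simp⟩
      intro x hx y hy
      rw [h3] at hx
      simp at hx hy
      subst hx hy
      exact hs

theorem IsDirectedPath.le {a : ℕ × ℕ} {l : List (ℕ × ℕ)} :
    ∀ {b : ℕ × ℕ}, IsDirectedPath a b l → a ≤ b := by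
  induction l using List.reverseRecOn with
  | nil => rintro b ⟨-, h, -⟩; simp at h
  | append_singleton l x ih =>
    intro b h
    rcases isDirectedPath_iff.1 h with ⟨rfl, -⟩ | ⟨c, l', hs, hc, hl⟩
    · exact le_rfl
    · obtain ⟨rfl, -⟩ := List.append_inj' hl rfl
      refine (ih hc).trans ?_
      rcases hs with rfl | rfl <;> simp [Prod.le_def]

theorem lastPassage_zero_left (w : ℕ → ℕ → ℕ) (n : ℕ) : lastPassage w 0 n = 0 := by
  have h : pathWeights w 0 n = ∅ := by
    refine Set.eq_empty_of_forall_notMem ?_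
    rintro s ⟨l, hl, -⟩
    simpa using hl.le.1
  simp [lastPassage, h]

theorem lastPassage_zero_right (w : ℕ → ℕ → ℕ) (m : ℕ) : lastPassage w m 0 = 0 := by
  have h : pathWeights w m 0 = ∅ := by
    refine Set.eq_empty_of_forall_notMem ?_
    rintro s ⟨l, hl, -⟩
    simpa using hl.le.2
  simp [lastPassage, h]

theorem lastPassage_succ_succ (w : ℕ → ℕ → ℕ) (m n : ℕ) :
    lastPassage w (m + 1) (n + 1) =
      max (lastPassage w m (n + 1)) (lastPassage w (m + 1) n) + w (m + 1) (n + 1) := by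
  obtain ⟨hmem, hub⟩ := isGreatest_lastPassage w (Nat.le_add_left 1 m) (Nat.le_add_left 1 n)
  have hle {i j : ℕ} {l : List (ℕ × ℕ)} (hl : IsDirectedPath (1, 1) (i, j) l) :
      (l.map fun p => w p.1 p.2).sum ≤ lastPassage w i j :=
    le_csSup (pathWeights_bddAbove w i j) ⟨l, hl, rfl⟩
  have hw : w (m + 1) (n + 1) ≤ lastPassage w (m + 1) (n + 1) := by
    obtain ⟨l, hl, hsum⟩ := hmem
    rw [hsum]
    rcases isDirectedPath_iff.1 hl with ⟨-, rfl⟩ | ⟨c, l', -, -, rfl⟩ <;> simp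
  have hext {i j : ℕ} (hs : Step (i, j) (m + 1, n + 1)) :
      lastPassage w i j + w (m + 1) (n + 1) ≤ lastPassage w (m + 1) (n + 1) := by
    rcases Nat.eq_zero_or_pos i with rfl | hi
    · simpa [lastPassage_zero_left] using hw
    rcases Nat.eq_zero_or_pos j with rfl | hj
    · simpa [lastPassage_zero_right] using hw
    obtain ⟨l, hl, hsum⟩ := (isGreatest_lastPassage w hi hj).1
    rw [hsum]
    exact hub ⟨l ++ [(m + 1, n + 1)], isDirectedPath_iff.2 (Or.inr ⟨_, _, hs, hl, rfl⟩), by simp⟩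
  refine le_antisymm ?_ ?_
  · obtain ⟨l, hl, hsum⟩ := hmem
    rw [hsum]
    rcases isDirectedPath_iff.1 hl with ⟨-, rfl⟩ | ⟨⟨i, j⟩, l', hs, hl', rfl⟩
    · simp
    · simp only [List.map_append, List.map_cons, List.map_nil, List.sum_append, List.sum_cons,
        List.sum_nil, add_zero, add_le_add_iff_right]
      rcases hs with h | h <;> simp only [Prod.mk.injEq, add_left_inj] at h <;>
        obtain ⟨rfl, rfl⟩ := h
      · exact (hle hl').trans (le_max_left _ _)
      · exact (hle hl').trans (le_max_right _ _)
  · rw [← max_add_add_right]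
    exact max_le (hext (Or.inl rfl)) (hext (Or.inr rfl))

theorem lastPassage_congr {w w' : ℕ → ℕ → ℕ} {m n : ℕ}
    (h : ∀ i j, 1 ≤ i → i ≤ m → 1 ≤ j → j ≤ n → w i j = w' i j) :
    lastPassage w m n = lastPassage w' m n := by
  induction m generalizing n with
  | zero => simp [lastPassage_zero_left]
  | succ m ihm =>
    induction n with
    | zero => simp [lastPassage_zero_right]
    | succ n ihn =>
      rw [lastPassage_succ_succ, lastPassage_succ_succ,
        ihm fun i j h1 h2 h3 h4 => h i j h1 (by omega) h3 h4,
        ihn fun i j h1 h2 h3 h4 => h i j h1 h2 h3 (by omega),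
        h _ _ (by omega) le_rfl (by omega) le_rfl]

theorem lastPassage_mono_left (w : ℕ → ℕ → ℕ) (n : ℕ) : Monotone fun m => lastPassage w m n := by
  refine monotone_nat_of_le_succ fun m => ?_
  cases n with
  | zero => simp [lastPassage_zero_right]
  | succ n =>
    rw [lastPassage_succ_succ]
    exact (le_max_left _ _).trans (Nat.le_add_right _ _)

/-- The last-passage times of the column `n + 1` are equal to `y` exactly if the weights of this
column are the increments of `y` over `max (G(i, n)) (y (i - 1))`. The columns are listed from the
top, as the parts of a partition. -/
theorem lastPassage_eq_iff (w : ℕ → ℕ → ℕ) (m n : ℕ) (y : ℕ → ℕ) (hym : y m = 0) :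
    (∀ k : Fin m, lastPassage w (m - k) (n + 1) = y k) ↔
      ∀ k : Fin m, max (lastPassage w (m - k) n) (y (k + 1)) + w (m - k) (n + 1) = y k := by
  have hrec (k : Fin m) : lastPassage w (m - k) (n + 1) =
      max (lastPassage w (m - k) n) (lastPassage w (m - (k + 1)) (n + 1)) +
        w (m - k) (n + 1) := by
    have h := lastPassage_succ_succ w (m - (k + 1)) n
    rw [show m - (k + 1 : ℕ) + 1 = m - k by omega] at h
    rw [h, max_comm]
  constructor
  · intro h k
    have hk : lastPassage w (m - (k + 1)) (n + 1) = y (k + 1) := by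
      by_cases hk : (k : ℕ) + 1 < m
      · exact h ⟨k + 1, hk⟩
      · have hk' : (k : ℕ) + 1 = m := by omega
        rw [hk', Nat.sub_self, lastPassage_zero_left, hym]
    rw [← h k, hrec k, hk]
  · intro h
    have key : ∀ i ≤ m, lastPassage w i (n + 1) = y (m - i) := by
      intro i
      induction i with
      | zero => simp [lastPassage_zero_left, hym]
      | succ i ih =>
        intro hi
        have hk := hrec ⟨m - (i + 1), by omega⟩
        have hi' : m - (m - i) = i := by omega
        have hy := h ⟨m - (i + 1), by omega⟩
        simp only [show m - (m - (i + 1)) = i + 1 by omega,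
          show m - (i + 1) + 1 = m - i by omega] at hk hy
        rw [hk, hi', ih (by omega), hy]
    intro k
    rw [key _ (by omega), show m - (m - (k : ℕ)) = k by omega]

/-! ### The law of the last-passage times -/

section Law

variable {Ω : Type*} [MeasurableSpace Ω] {μ : Measure Ω} {q : ℕ → ℝ} {W : ℕ → ℕ → Ω → ℕ}

/-- The position `(m - k, n + 1)` of the `k`-th weight of the column `n + 1`, counted from the
top. -/
def columnIndex (m n : ℕ) (k : Fin m) : ℕ+ × ℕ+ :=
  (⟨m - k, by omega⟩, ⟨n + 1, by omega⟩)

theorem columnIndex_injective (m n : ℕ) : Function.Injective (columnIndex m n) := by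
  intro k l h
  have h1 : m - (k : ℕ) = m - (l : ℕ) := congrArg (fun p : ℕ+ × ℕ+ => (p.1 : ℕ)) h
  exact Fin.ext (by omega)

theorem indepFun_lastPassage_column (hmeas : ∀ i j : ℕ, 1 ≤ i → 1 ≤ j → Measurable (W i j))
    (hindep : iIndepFun (fun p : ℕ+ × ℕ+ => W p.1 p.2) μ) (m n : ℕ) :
    IndepFun (fun ω (k : Fin m) => lastPassage (fun i j => W i j ω) (m - k) n)
      (fun ω (k : Fin m) => W (m - k) (n + 1) ω) μ := by
  -- The first vector is a function of the weights with indices in `S`, the second one of those with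
  -- indices in `T`.
  set S : Finset (ℕ+ × ℕ+) := (Finset.Icc 1 m.succPNat ×ˢ Finset.Icc 1 n.succPNat).filter
    fun p => (p.2 : ℕ) ≤ n with hS
  set T : Finset (ℕ+ × ℕ+) := Finset.univ.image (columnIndex m n) with hT
  have hST : Disjoint S T := by
    rw [Finset.disjoint_left]
    intro p hp hp'
    obtain ⟨k, -, rfl⟩ := Finset.mem_image.1 hp'
    have := (Finset.mem_filter.1 hp).2
    simp [columnIndex] at this
  have hmemS {i j : ℕ} (h : (1 ≤ i ∧ i ≤ m) ∧ 1 ≤ j ∧ j ≤ n) :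
      ((⟨i, h.1.1⟩, ⟨j, h.2.1⟩) : ℕ+ × ℕ+) ∈ S :=
    Finset.mem_filter.2 ⟨Finset.mem_product.2
      ⟨Finset.mem_Icc.2 ⟨one_le, (show i ≤ m + 1 by omega)⟩,
        Finset.mem_Icc.2 ⟨one_le, (show j ≤ n + 1 by omega)⟩⟩, h.2.2⟩
  have hind := hindep.indepFun_finset S T hST fun p => hmeas _ _ p.1.2 p.2.2
  have hcomp := hind.comp
    (φ := fun (v : S → ℕ) (k : Fin m) => lastPassage (fun i j =>
      if h : (1 ≤ i ∧ i ≤ m) ∧ 1 ≤ j ∧ j ≤ n then v ⟨_, hmemS h⟩ else 0) (m - k) n)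
    (ψ := fun (v : T → ℕ) (k : Fin m) =>
      v ⟨columnIndex m n k, Finset.mem_image_of_mem _ (Finset.mem_univ k)⟩)
    (Measurable.of_discrete) (Measurable.of_discrete)
  convert hcomp using 1
  · ext ω k
    refine lastPassage_congr fun i j h1 h2 h3 h4 => ?_
    rw [dif_pos ⟨⟨h1, by omega⟩, h3, h4⟩]
    rfl
  · rfl

theorem measureReal_column [IsProbabilityMeasure μ]
    (hindep : iIndepFun (fun p : ℕ+ × ℕ+ => W p.1 p.2) μ)
    (hgeom : ∀ i j : ℕ, 1 ≤ i → 1 ≤ j → ∀ k : ℕ,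
      μ.real {ω | W i j ω = k} = (1 - q j) * q j ^ k) (m n : ℕ) (d : Fin m → ℕ) :
    μ.real {ω | ∀ k : Fin m, W (m - k) (n + 1) ω = d k} =
      (1 - q (n + 1)) ^ m * ∏ k, q (n + 1) ^ d k := by
  have h := (hindep.precomp (columnIndex_injective m n)).measure_inter_preimage_eq_mul
    Finset.univ (sets := fun k => {d k}) fun _ _ => measurableSet_singleton _
  have hset : {ω | ∀ k : Fin m, W (m - k) (n + 1) ω = d k} =
      ⋂ k ∈ (Finset.univ : Finset (Fin m)),
        (fun ω => W (columnIndex m n k).1 (columnIndex m n k).2 ω) ⁻¹' {d k} := by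
    ext ω; simp [columnIndex]
  rw [hset, Measure.real, h, ENNReal.toReal_prod]
  have hk (k : Fin m) := hgeom (m - k) (n + 1) (by omega) (by omega) (d k)
  simp only [Measure.real] at hk
  rw [← Fin.prod_const, ← Finset.prod_mul_distrib]
  exact Finset.prod_congr rfl fun k _ => hk k

theorem measurable_lastPassage (hmeas : ∀ i j : ℕ, 1 ≤ i → 1 ≤ j → Measurable (W i j))
    (m n : ℕ) : Measurable fun ω => lastPassage (fun i j => W i j ω) m n := by
  induction m generalizing n with
  | zero => simp [lastPassage_zero_left]
  | succ m ihm =>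
    induction n with
    | zero => simp [lastPassage_zero_right]
    | succ n ihn =>
      simp only [lastPassage_succ_succ]
      exact ((ihm (n + 1)).max ihn).add (hmeas _ _ (by omega) (by omega))

theorem antitone_lastPassage (w : ℕ → ℕ → ℕ) (m n : ℕ) :
    Antitone fun k : Fin m => lastPassage w (m - k) n :=
  fun _ _ h => lastPassage_mono_left w n (Nat.sub_le_sub_left h m)

/-- The transition from the column `n` to the column `n + 1`. -/
theorem measureReal_lastPassage_succ [IsProbabilityMeasure μ]
    (hmeas : ∀ i j : ℕ, 1 ≤ i → 1 ≤ j → Measurable (W i j))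
    (hindep : iIndepFun (fun p : ℕ+ × ℕ+ => W p.1 p.2) μ)
    (hgeom : ∀ i j : ℕ, 1 ≤ i → 1 ≤ j → ∀ k : ℕ,
      μ.real {ω | W i j ω = k} = (1 - q j) * q j ^ k)
    (m n : ℕ) (y : ℕ → ℕ) (hy : Antitone y) (hym : y m = 0) :
    μ.real {ω | ∀ k : Fin m, lastPassage (fun i j => W i j ω) (m - k) (n + 1) = y k} =
      ∑ x ∈ (Fintype.piFinset fun i : Fin m => Finset.Icc 0 (y i)) with Antitone x,
        μ.real {ω | ∀ k : Fin m, lastPassage (fun i j => W i j ω) (m - k) n = x k} *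
          ((1 - q (n + 1)) ^ m * ∏ i : Fin m, q (n + 1) ^ (y i - max (x i) (y (i + 1)))) := by
  classical
  set X : Ω → Fin m → ℕ := fun ω k => lastPassage (fun i j => W i j ω) (m - k) n with hX
  set D : Ω → Fin m → ℕ := fun ω k => W (m - k) (n + 1) ω with hD
  have hXD : IndepFun X D μ := indepFun_lastPassage_column hmeas hindep m n
  set inc : (Fin m → ℕ) → Fin m → ℕ := fun x k => y k - max (x k) (y (k + 1)) with hinc
  have hset : {ω | ∀ k : Fin m, lastPassage (fun i j => W i j ω) (m - k) (n + 1) = y k} =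
      ⋃ x ∈ (Fintype.piFinset fun i : Fin m => Finset.Icc 0 (y i)).filter (Antitone ·),
        X ⁻¹' {x} ∩ D ⁻¹' {inc x} := by
    ext ω
    simp only [Set.mem_ofPred_eq, lastPassage_eq_iff _ m n y hym, Set.mem_iUnion, Set.mem_inter_iff,
      Set.mem_preimage, Set.mem_singleton_iff, Finset.mem_filter, Fintype.mem_piFinset,
      Finset.mem_Icc, zero_le, true_and, exists_prop]
    constructor
    · intro h
      refine ⟨X ω, ⟨fun k => ?_, antitone_lastPassage _ m n⟩, rfl, ?_⟩
      · have := h k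
        simp only [hX]; omega
      · ext k
        have := h k
        simp only [hX, hD, hinc]; omega
    · rintro ⟨x, ⟨hxy, -⟩, hx, hd⟩ k
      have h1 : lastPassage (fun i j => W i j ω) (m - k) n = x k := congrFun hx k
      have h2 : W (m - k) (n + 1) ω = y k - max (x k) (y (k + 1)) := congrFun hd k
      have h3 := hxy k
      have h4 := hy (Nat.le_succ k)
      rw [h1, h2]
      simp only [Nat.succ_eq_add_one] at h4
      omega
  have hXm : Measurable X := measurable_pi_lambda _ fun k => measurable_lastPassage hmeas _ _
  have hDm : Measurable D := measurable_pi_lambda _ fun k => hmeas _ _ (by omega) (by omega)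
  rw [hset, measureReal_biUnion_finset]
  · refine Finset.sum_congr rfl fun x _ => ?_
    rw [measureReal_def, hXD.measure_inter_preimage_eq_mul _ _ (measurableSet_singleton _)
      (measurableSet_singleton _), ENNReal.toReal_mul]
    have hD' : D ⁻¹' {inc x} = {ω | ∀ k : Fin m, W (m - k) (n + 1) ω = inc x k} := by
      ext ω; exact funext_iff
    have hX' : X ⁻¹' {x} =
        {ω | ∀ k : Fin m, lastPassage (fun i j => W i j ω) (m - k) n = x k} := by
      ext ω; exact funext_iff
    rw [hD', ← measureReal_def, ← measureReal_def, measureReal_column hindep hgeom, hX']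
  · intro x _ x' _ hne
    refine Set.disjoint_left.2 fun ω h h' => hne ?_
    exact h.1.symm.trans h'.1
  · exact fun x _ => (hXm (measurableSet_singleton _)).inter (hDm (measurableSet_singleton _))

/-- Before the first column all last-passage times are zero, and the determinant is `1` for the
empty partition and `0` for all others. -/
theorem det_complSymm_zero (m : ℕ) (q : ℕ → ℝ) (lam : Fin m → ℕ) (hlam : Antitone lam) :
    (Matrix.of fun i j : Fin m => complSymm ((lam i : ℤ) - (i : ℕ) + (j : ℕ)) i 0 q).det =
      if ∀ k, 0 = lam k then 1 else 0 := by
  split_ifs with h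
  · rw [Matrix.det_of_isUpperTriangular]
    · refine Finset.prod_eq_one fun i _ => ?_
      rw [Matrix.of_apply, ← h i, show (((0 : ℕ) : ℤ) - (i : ℕ) + (i : ℕ)) = 0 by simp,
        complSymm_zero]
    · intro i j hij
      have : (j : ℕ) < i := hij
      rw [Matrix.of_apply, ← h i, complSymm_of_neg (by omega)]
  · push Not at h
    obtain ⟨k, hk⟩ := h
    have hm : 0 < m := k.pos
    have h0 : 0 < lam ⟨0, hm⟩ :=
      lt_of_lt_of_le (Nat.pos_of_ne_zero hk.symm) (hlam (Fin.mk_le_of_le_val (Nat.zero_le _)))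
    refine Matrix.det_eq_zero_of_row_eq_zero ⟨0, hm⟩ fun j => ?_
    exact complSymm_no_vars ((lam ⟨0, hm⟩ : ℤ) - (0 : ℕ) + (j : ℕ)) (by omega) q

/-- The law of the last-passage times in terms of complete homogeneous symmetric polynomials, by
induction on the number of columns. -/
theorem measureReal_lastPassage_eq_det_complSymm [IsProbabilityMeasure μ]
    (hmeas : ∀ i j : ℕ, 1 ≤ i → 1 ≤ j → Measurable (W i j))
    (hindep : iIndepFun (fun p : ℕ+ × ℕ+ => W p.1 p.2) μ)
    (hgeom : ∀ i j : ℕ, 1 ≤ i → 1 ≤ j → ∀ k : ℕ,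
      μ.real {ω | W i j ω = k} = (1 - q j) * q j ^ k)
    (m n : ℕ) (lam : Fin m → ℕ) (hlam : Antitone lam) :
    μ.real {ω | ∀ k : Fin m, lastPassage (fun i j => W i j ω) (m - k) n = lam k} =
      (∏ j ∈ Finset.Icc 1 n, (1 - q j) ^ m) *
        (Matrix.of fun i j : Fin m => complSymm ((lam i : ℤ) - (i : ℕ) + (j : ℕ)) i n q).det := by
  induction n generalizing lam with
  | zero =>
    rw [det_complSymm_zero m q lam hlam]
    simp only [lastPassage_zero_right]
    by_cases h : ∀ k, 0 = lam k
    · rw [if_pos h, Set.eq_univ_of_forall (s := {_ω : Ω | ∀ k, 0 = lam k}) fun _ => h]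
      simp
    · simp [h]
  | succ n ih =>
    -- The partition is continued by zeros, so that `y (k + 1)` makes sense for the last part.
    obtain ⟨y, hy, hym, hylam⟩ : ∃ y : ℕ → ℕ, Antitone y ∧ y m = 0 ∧ ∀ k : Fin m, y k = lam k := by
      refine ⟨fun i => if h : i < m then lam ⟨i, h⟩ else 0, fun i j hij => ?_, by simp, by simp⟩
      by_cases hj : j < m
      · simpa [hj, hij.trans_lt hj] using
          hlam (show (⟨i, hij.trans_lt hj⟩ : Fin m) ≤ ⟨j, hj⟩ from hij)
      · simp [hj]
    simp only [← hylam]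
    rw [measureReal_lastPassage_succ hmeas hindep hgeom m n y hy hym,
      ← sum_antitone_mul_det_complSymm m n q y hy hym, Finset.prod_Icc_succ_top (by omega),
      Finset.mul_sum]
    refine Finset.sum_congr rfl fun x hx => ?_
    rw [ih x (Finset.mem_filter.1 hx).2]
    ring

end Law

/-! ### Passing to the conjugate partition -/

/-- Complementary minors of a matrix and of its inverse. -/
theorem det_toBlocks₁₁_of_mul_eq_one {m n : Type*} [Fintype m] [DecidableEq m] [Fintype n]
    [DecidableEq n] (A B : Matrix (m ⊕ n) (m ⊕ n) ℝ) (h : A * B = 1) :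
    A.toBlocks₁₁.det = A.det * B.toBlocks₂₂.det := by
  have h' := h
  rw [← Matrix.fromBlocks_toBlocks A, ← Matrix.fromBlocks_toBlocks B, Matrix.fromBlocks_multiply,
    ← Matrix.fromBlocks_one, Matrix.fromBlocks_inj] at h'
  have key : A * Matrix.fromBlocks 1 B.toBlocks₁₂ 0 B.toBlocks₂₂ =
      Matrix.fromBlocks A.toBlocks₁₁ 0 A.toBlocks₂₁ 1 := by
    conv_lhs => rw [← Matrix.fromBlocks_toBlocks A]
    rw [Matrix.fromBlocks_multiply, h'.2.1, h'.2.2.2]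
    simp
  have hdet := congrArg Matrix.det key
  rw [Matrix.det_mul, Matrix.det_fromBlocks_zero₂₁, Matrix.det_fromBlocks_zero₁₂, Matrix.det_one,
    Matrix.det_one, one_mul, mul_one] at hdet
  exact hdet.symm

open PowerSeries in
theorem sum_intCoeff_mul_intCoeff (f g : ℝ⟦X⟧) {N s : ℕ} (v : ℕ) (hs : s < N) :
    ∑ u : Fin N, intCoeff f ((s : ℤ) - (u : ℕ)) * intCoeff g ((u : ℕ) - (v : ℤ)) =
      intCoeff (g * f) (s - v) := by
  rw [Fin.sum_univ_eq_sum_range (fun u => intCoeff f ((s : ℤ) - u) * intCoeff g (u - (v : ℤ)))]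
  have hzero : ∀ u ∈ Finset.range N, u ∉ Finset.Ico v (s + 1) →
      intCoeff f ((s : ℤ) - u) * intCoeff g (u - (v : ℤ)) = 0 := by
    intro u _ hu
    rw [Finset.mem_Ico, not_and_or] at hu
    rcases hu with hu | hu
    · rw [intCoeff, intCoeff, if_neg (by omega : ¬ 0 ≤ (u : ℤ) - v), mul_zero]
    · rw [intCoeff, if_neg (by omega), zero_mul]
  rw [← Finset.sum_subset (fun u hu => ?_) hzero]
  · rcases lt_or_ge s v with h | h
    · rw [Finset.Ico_eq_empty (by omega), Finset.sum_empty, intCoeff, if_neg (by omega)]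
    · rw [intCoeff, if_pos (by omega), coeff_mul, Finset.Nat.sum_antidiagonal_eq_sum_range_succ_mk,
        Finset.sum_Ico_eq_sum_range]
      have hsv : ((s : ℤ) - v).toNat = s - v := by omega
      rw [hsv, show s + 1 - v = (s - v).succ by omega]
      refine Finset.sum_congr rfl fun k hk => ?_
      have hk := Finset.mem_range.1 hk
      rw [intCoeff, intCoeff, if_pos (by omega), if_pos (by omega), mul_comm]
      congr 3 <;> omega
  · rw [Finset.mem_Ico] at hu
    exact Finset.mem_range.2 (by omega)

open PowerSeries in
theorem denom_mul_inv_denom {a b : ℕ} (hab : a ≤ b) (n : ℕ) (q : ℕ → ℝ) :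
    denom b n q * (denom a n q)⁻¹ = (1 - X) ^ (b - a) := by
  have h : denom b n q = (1 - X) ^ (b - a) * denom a n q := by
    rw [denom, denom, ← mul_assoc, ← pow_add, Nat.sub_add_cancel hab]
  rw [h, mul_assoc, denom_mul_inv, mul_one]

open PowerSeries in
theorem coeff_one_sub_X_pow_eq_zero {d k : ℕ} (h : d < k) : coeff k ((1 - X : ℝ⟦X⟧) ^ d) = 0 := by
  have hp : ((1 - X : ℝ⟦X⟧) ^ d) = (((1 - Polynomial.X) ^ d : Polynomial ℝ) : ℝ⟦X⟧) := by simp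
  rw [hp, Polynomial.coeff_coe]
  refine Polynomial.coeff_eq_zero_of_natDegree_lt (lt_of_le_of_lt ?_ h)
  refine Polynomial.natDegree_pow_le_of_le d (?_ : _ ≤ 1) |>.trans (by simp)
  exact (Polynomial.natDegree_sub_le _ _).trans (by simp)

/-- Two mutually inverse unitriangular matrices. Their entries are `h_k(1^a, q_1, …, q_n)` with
`a = c s` in row `s`, and `(-1)^k * e_k(1^b, q_1, …, q_n)` with `b = c (v + 1)` in column `v`. The
entry `(s, v)`, `v < s`, of the product is the coefficient of `t^(s - v)` in
`(1 - t)^(c (v + 1) - c s)`; it vanishes because `c` decreases by at most one in each step. -/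
theorem complSymm_matrix_mul_elemSymm_matrix (N n : ℕ) (q : ℕ → ℝ) (c : ℕ → ℕ)
    (hc : ∀ s, c (s + 1) ≤ c s) (hc' : ∀ s, c s ≤ c (s + 1) + 1) :
    (Matrix.of fun s u : Fin N => complSymm (((s : ℕ) : ℤ) - (u : ℕ)) (c s) n q) *
      (Matrix.of fun u v : Fin N =>
        intCoeff (denom (c (v + 1)) n q) (((u : ℕ) : ℤ) - (v : ℕ))) = 1 := by
  have hanti : Antitone c := antitone_nat_of_succ_le hc
  have hgrow : ∀ a d, c a ≤ c (a + d) + d := by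
    intro a d
    induction d with
    | zero => simp
    | succ d ih => have := hc' (a + d); rw [show a + (d + 1) = a + d + 1 from rfl]; omega
  ext s v
  rw [Matrix.mul_apply]
  simp only [Matrix.of_apply, complSymm_eq_intCoeff]
  rw [sum_intCoeff_mul_intCoeff _ _ _ s.2, intCoeff]
  rcases lt_trichotomy s v with h | rfl | h
  · have h' : (s : ℕ) < v := h
    rw [if_neg (by omega), Matrix.one_apply_ne h.ne]
  · rw [if_pos (by omega), Matrix.one_apply_eq, sub_self, Int.toNat_zero,
      PowerSeries.coeff_zero_eq_constantCoeff_apply, map_mul, PowerSeries.constantCoeff_inv,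
      constantCoeff_denom, constantCoeff_denom]
    simp
  · have h' : (v : ℕ) < s := h
    have hd := hgrow (v + 1) (s - (v + 1))
    rw [show (v : ℕ) + 1 + (s - (v + 1)) = s by omega] at hd
    rw [if_pos (by omega), Matrix.one_apply_ne h.ne',
      denom_mul_inv_denom (hanti (show (v : ℕ) + 1 ≤ s from h')),
      coeff_one_sub_X_pow_eq_zero (by omega)]

/-! ### Particles and holes of a partition -/

/-!
In this part the partition `x 0 ≤ x 1 ≤ ⋯` is listed in increasing order. Row `k` of the diagram is
encoded by a particle at the position `x k + k`, column `i` by a hole at the position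
`m + i - conjPart x i`. If all parts are at most `L`, then the `m` particles and the `L` holes fill
the positions `0, …, m + L - 1`.
-/

section Conjugate

variable {m : ℕ} {x : Fin m → ℕ}

theorem conjPart_le (x : Fin m → ℕ) (i : ℕ) : conjPart x i ≤ m :=
  (Finset.card_le_univ _).trans (by simp)

theorem conjPart_antitone (x : Fin m → ℕ) : Antitone (conjPart x) := fun _ _ hij =>
  Finset.card_le_card (Finset.monotone_filter_right _ fun _ _ h => lt_of_le_of_lt hij h)

/-- The parts of the conjugate partition count the parts `x k` with `i < x k`, which are the last
ones. -/
theorem lt_iff_le_conjPart_add (hx : Monotone x) (i : ℕ) (k : Fin m) :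
    i < x k ↔ m ≤ conjPart x i + k := by
  constructor
  · intro h
    have hsub : Finset.Ici k ⊆ Finset.univ.filter fun l => i < x l := fun l hl => by
      simpa using h.trans_le (hx (Finset.mem_Ici.1 hl))
    have := Finset.card_le_card hsub
    rw [Fin.card_Ici] at this
    rw [conjPart]
    omega
  · intro h
    by_contra hlt
    have hsub : (Finset.univ.filter fun l => i < x l) ⊆ Finset.Ioi k := fun l hl => by
      rw [Finset.mem_Ioi]
      by_contra hle
      have := hx (not_lt.1 hle)
      have hl := (Finset.mem_filter.1 hl).2
      omega
    have := Finset.card_le_card hsub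
    rw [Fin.card_Ioi] at this
    rw [conjPart] at h
    omega

/-- The hole of the column `i` of the diagram lies below the particle of the row `k` exactly if the
box `(k, i)` belongs to the diagram. -/
theorem hole_lt_particle_iff (hx : Monotone x) (i : ℕ) (k : Fin m) :
    m + i - conjPart x i < x k + k ↔ i < x k := by
  have h1 := lt_iff_le_conjPart_add hx i k
  have h2 := conjPart_le x i
  omega

theorem hole_ne_particle (hx : Monotone x) (i : ℕ) (k : Fin m) :
    m + i - conjPart x i ≠ x k + k := by
  have h1 := lt_iff_le_conjPart_add hx i k
  have h2 := conjPart_le x i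
  omega

theorem particle_strictMono (hx : Monotone x) : StrictMono fun k : Fin m => x k + k :=
  fun k l h => by
    have := hx h.le
    have h' : (k : ℕ) < l := h
    simp only; omega

/-- The number of particles at or above the position `s`. -/
def particlesFrom (x : Fin m → ℕ) (s : ℕ) : ℕ :=
  (Finset.univ.filter fun k : Fin m => s ≤ x k + k).card

theorem particlesFrom_succ_le (x : Fin m → ℕ) (s : ℕ) :
    particlesFrom x (s + 1) ≤ particlesFrom x s :=
  Finset.card_le_card (Finset.monotone_filter_right _ fun _ _ h => Nat.le_of_succ_le h)

theorem particlesFrom_le_succ (hx : Monotone x) (s : ℕ) :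
    particlesFrom x s ≤ particlesFrom x (s + 1) + 1 := by
  have hsub : (Finset.univ.filter fun k : Fin m => s ≤ x k + k) ⊆
      (Finset.univ.filter fun k : Fin m => s + 1 ≤ x k + k) ∪
        Finset.univ.filter fun k : Fin m => x k + k = s := fun k hk => by
    have := (Finset.mem_filter.1 hk).2
    simp only [Finset.mem_union, Finset.mem_filter, Finset.mem_univ, true_and]
    omega
  refine (Finset.card_le_card hsub).trans ((Finset.card_union_le _ _).trans ?_)
  refine Nat.add_le_add_left (Finset.card_le_one.2 fun k hk l hl => ?_) _
  exact (particle_strictMono hx).injective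
    ((Finset.mem_filter.1 hk).2.trans (Finset.mem_filter.1 hl).2.symm)

theorem particlesFrom_particle (hx : Monotone x) (k : Fin m) :
    particlesFrom x (x k + k) = m - k := by
  rw [particlesFrom, ← Fin.card_Ici]
  congr 1
  ext l
  simpa using (particle_strictMono hx).le_iff_le

theorem particlesFrom_hole_succ (hx : Monotone x) (i : ℕ) :
    particlesFrom x (m + i - conjPart x i + 1) = conjPart x i := by
  rw [particlesFrom, conjPart]
  congr 1
  ext l
  simpa [Nat.succ_le_iff, conjPart] using hole_lt_particle_iff hx i l

/-- The positions of the particles, followed by the positions of the holes, form a permutation of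
all positions. -/
theorem exists_particle_hole_perm (hx : Monotone x) {L : ℕ} (hL : ∀ k, x k ≤ L) :
    ∃ σ : Equiv.Perm (Fin (m + L)),
      (∀ k : Fin m, (σ (Fin.castAdd L k) : ℕ) = x k + k) ∧
      ∀ i : Fin L, (σ (Fin.natAdd m i) : ℕ) = m + i - conjPart x i := by
  set f : Fin (m + L) → Fin (m + L) := Fin.addCases
    (fun k => ⟨x k + k, by have := hL k; omega⟩) (fun i => ⟨m + i - conjPart x i, by omega⟩) with hf
  have hinj : Function.Injective f := by
    have hmono : StrictMono fun i : Fin L => m + (i : ℕ) - conjPart x i := fun i j hij => by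
      have h1 := conjPart_antitone x (Fin.le_def.1 hij.le)
      have h2 := conjPart_le x i
      have h3 : (i : ℕ) < j := hij
      simp only; omega
    intro a b
    refine Fin.addCases (fun k => ?_) (fun i => ?_) a <;>
      refine Fin.addCases (fun l => ?_) (fun j => ?_) b <;> intro h <;>
      simp only [hf, Fin.addCases_left, Fin.addCases_right, Fin.mk.injEq] at h
    · rw [(particle_strictMono hx).injective h]
    · exact absurd h.symm (hole_ne_particle hx j k)
    · exact absurd h (hole_ne_particle hx i l)
    · rw [hmono.injective h]
  refine ⟨Equiv.ofBijective f (Finite.injective_iff_bijective.1 hinj), fun k => ?_, fun i => ?_⟩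
  · simp [hf]
  · simp [hf]

/-- A permutation of `Fin (m + L)` that is increasing on the first `m` and on the last `L` elements
has as many inversions as there are pairs of elements from the two parts in the wrong order. -/
theorem sign_eq_prod_of_strictMonoOn {m L : ℕ} (σ : Equiv.Perm (Fin (m + L)))
    (h₁ : StrictMono fun k => σ (Fin.castAdd L k)) (h₂ : StrictMono fun i => σ (Fin.natAdd m i)) :
    Equiv.Perm.sign σ =
      ∏ i : Fin L, ∏ k : Fin m, if σ (Fin.castAdd L k) < σ (Fin.natAdd m i) then 1 else -1 := by
  have hIio (b : Fin (m + L)) : ∏ a ∈ Finset.Iio b, (if σ a < σ b then (1 : ℤˣ) else -1) =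
      ∏ a, if a < b then if σ a < σ b then 1 else -1 else 1 := by
    rw [← Finset.prod_filter]
    congr 1
    ext a; simp
  rw [Equiv.Perm.sign_eq_prod_prod_Iio]
  simp only [hIio]
  rw [Fin.prod_univ_add, Finset.prod_eq_one, one_mul]
  · refine Finset.prod_congr rfl fun i _ => ?_
    rw [Fin.prod_univ_add]
    rw [Finset.prod_eq_one (s := (Finset.univ : Finset (Fin L))), mul_one]
    · refine Finset.prod_congr rfl fun k _ => ?_
      rw [if_pos (Fin.lt_def.2 (by simp; omega))]
    · intro j _
      split_ifs with ha hb
      · rfl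
      · exact absurd (h₂ ((Fin.natAdd_lt_natAdd_iff m).1 ha)) hb
      · rfl
  · intro k _
    refine Finset.prod_eq_one fun a _ => ?_
    split_ifs with ha hb
    · rfl
    · refine absurd ?_ hb
      have ha' : (a : ℕ) < k := by simpa using Fin.lt_def.1 ha
      have haa : a = Fin.castAdd L ⟨a, ha'.trans k.2⟩ := Fin.ext rfl
      rw [haa]
      exact h₁ (Fin.lt_def.2 ha')
    · rfl

theorem sign_particle_hole_perm (hx : Monotone x) {L : ℕ} (σ : Equiv.Perm (Fin (m + L)))
    (h₁ : ∀ k : Fin m, (σ (Fin.castAdd L k) : ℕ) = x k + k)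
    (h₂ : ∀ i : Fin L, (σ (Fin.natAdd m i) : ℕ) = m + i - conjPart x i) :
    Equiv.Perm.sign σ = ∏ i : Fin L, (-1) ^ conjPart x i := by
  rw [sign_eq_prod_of_strictMonoOn]
  · refine Finset.prod_congr rfl fun i _ => ?_
    have hk (k : Fin m) : (if σ (Fin.castAdd L k) < σ (Fin.natAdd m i) then (1 : ℤˣ) else -1) =
        if (i : ℕ) < x k then -1 else 1 := by
      have h3 := hole_lt_particle_iff hx i k
      have h4 := hole_ne_particle hx i k
      have h5 : σ (Fin.castAdd L k) < σ (Fin.natAdd m i) ↔ ¬(i : ℕ) < x k := by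
        rw [Fin.lt_def, h₁, h₂]
        omega
      simp only [h5, ite_not]
    simp only [hk]
    rw [← Finset.prod_filter, Finset.prod_const, conjPart]
  · intro k l hkl
    rw [Fin.lt_def, h₁, h₁]
    exact particle_strictMono hx hkl
  · intro i j hij
    have h3 := conjPart_antitone x (Fin.le_def.1 hij.le)
    have h4 := conjPart_le x i
    have h5 : (i : ℕ) < j := hij
    rw [Fin.lt_def, h₂, h₂]
    omega

/-- The dual Jacobi–Trudi identity, for a partition `x 0 ≤ x 1 ≤ ⋯` listed in increasing order. -/
theorem det_complSymm_eq_det_elemSymm_of_monotone (hx : Monotone x) {L : ℕ} (hL : ∀ k, x k ≤ L)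
    (n : ℕ) (q : ℕ → ℝ) :
    (Matrix.of fun i j : Fin m =>
        complSymm (((x i + i : ℕ) : ℤ) - (j : ℕ)) (m - i - 1) n q).det =
      (Matrix.of fun i j : Fin L =>
        elemSymm ((conjPart x i : ℤ) - (i : ℕ) + (j : ℕ)) (conjPart x i - 1) n q).det := by
  obtain ⟨σ, h₁, h₂⟩ := exists_particle_hole_perm hx hL
  -- With this number of ones the particle rows of the matrix of complete symmetric polynomials have
  -- the entries of the first determinant, and the hole columns of its inverse, up to sign, those of
  -- the second. The two minors are complementary.
  set c : ℕ → ℕ := fun s => particlesFrom x s - 1 with hc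
  have hmul := complSymm_matrix_mul_elemSymm_matrix (m + L) n q c
    (fun s => Nat.sub_le_sub_right (particlesFrom_succ_le x s) 1)
    (fun s => by have := particlesFrom_le_succ hx s; simp only [hc]; omega)
  set A := Matrix.of fun s u : Fin (m + L) => complSymm (((s : ℕ) : ℤ) - (u : ℕ)) (c s) n q with hA
  set B := Matrix.of fun u v : Fin (m + L) =>
    intCoeff (denom (c (v + 1)) n q) (((u : ℕ) : ℤ) - (v : ℕ)) with hB
  have hAdet : A.det = 1 := by
    rw [Matrix.det_of_isLowerTriangular]
    · refine Finset.prod_eq_one fun s _ => ?_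
      rw [hA, Matrix.of_apply, sub_self, complSymm_zero]
    · intro s u hsu
      have : (s : ℕ) < u := hsu
      rw [hA, Matrix.of_apply, complSymm_of_neg (by omega)]
  let e : Fin m ⊕ Fin L ≃ Fin (m + L) := finSumFinEquiv
  have hmul' : (A.submatrix (e.trans σ) e) * (B.submatrix e (e.trans σ)) = 1 := by
    rw [Matrix.submatrix_mul_equiv, hmul, Matrix.submatrix_one_equiv]
  have hdet := det_toBlocks₁₁_of_mul_eq_one _ _ hmul'
  have hAσ : (A.submatrix (e.trans σ) e).det = ∏ i : Fin L, (-1) ^ conjPart x i := by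
    have : A.submatrix (e.trans σ) e = (A.submatrix σ id).submatrix e e := by ext; rfl
    rw [this, Matrix.det_submatrix_equiv_self, Matrix.det_permute, hAdet,
      sign_particle_hole_perm hx σ h₁ h₂]
    simp
  have hA₁₁ : (A.submatrix (e.trans σ) e).toBlocks₁₁ = Matrix.of fun i j : Fin m =>
      complSymm (((x i + i : ℕ) : ℤ) - (j : ℕ)) (m - i - 1) n q := by
    ext i j
    simp only [Matrix.toBlocks₁₁, Matrix.of_apply, Matrix.submatrix_apply, hA, e, hc,
      Equiv.trans_apply, finSumFinEquiv_apply_left, h₁, particlesFrom_particle hx, Fin.val_castAdd]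
  have hB₂₂ : (B.submatrix e (e.trans σ)).toBlocks₂₂ = Matrix.of fun i j : Fin L =>
      (-1) ^ (conjPart x j + j) * (Matrix.of fun i j : Fin L => (-1) ^ (i : ℕ) *
        elemSymm ((conjPart x j : ℤ) - (j : ℕ) + (i : ℕ)) (conjPart x j - 1) n q) i j := by
    ext i j
    have hj := conjPart_le x j
    simp only [Matrix.toBlocks₂₂, Matrix.of_apply, Matrix.submatrix_apply, hB, e, hc,
      Equiv.trans_apply, finSumFinEquiv_apply_right, h₂, particlesFrom_hole_succ hx, Fin.val_natAdd,
      elemSymm_eq_intCoeff]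
    rw [show ((m + i : ℕ) : ℤ) - ((m + j - conjPart x j : ℕ) : ℤ) = conjPart x j - (j : ℕ) + (i : ℕ)
      by omega]
    by_cases hz : 0 ≤ (conjPart x j : ℤ) - (j : ℕ) + (i : ℕ)
    · rw [← mul_assoc, ← mul_assoc, ← pow_add, ← pow_add, Even.neg_one_pow, one_mul]
      exact ⟨conjPart x j + i, by omega⟩
    · rw [intCoeff, if_neg hz]; simp
  have hcol := Matrix.det_mul_column (fun i : Fin L => (-1 : ℝ) ^ (i : ℕ))
    (Matrix.of fun i j : Fin L =>
      elemSymm ((conjPart x i : ℤ) - (i : ℕ) + (j : ℕ)) (conjPart x i - 1) n q).transpose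
  simp only [Matrix.transpose_apply, Matrix.of_apply, Matrix.det_transpose] at hcol
  rw [hA₁₁, hAσ, hB₂₂, Matrix.det_mul_row, hcol] at hdet
  rw [hdet, ← mul_assoc, ← mul_assoc, ← Finset.prod_mul_distrib, ← Finset.prod_mul_distrib,
    Finset.prod_eq_one, one_mul]
  · intro i _
    rw [← pow_add, ← pow_add]
    exact Even.neg_one_pow ⟨conjPart x i + i, by omega⟩

end Conjugate

/-- The dual Jacobi–Trudi identity for the arguments `(1^a, q_1, …, q_n)`, where `a` depends on the
row. -/
theorem det_complSymm_eq_det_elemSymm {m : ℕ} (lam : Fin m → ℕ) (hlam : Antitone lam) {L : ℕ}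
    (hL : ∀ k, lam k ≤ L) (n : ℕ) (q : ℕ → ℝ) :
    (Matrix.of fun i j : Fin m => complSymm ((lam i : ℤ) - (i : ℕ) + (j : ℕ)) i n q).det =
      (Matrix.of fun i j : Fin L =>
        elemSymm ((conjPart lam i : ℤ) - (i : ℕ) + (j : ℕ)) (conjPart lam i - 1) n q).det := by
  have hx : Monotone (lam ∘ Fin.rev) := fun i j hij => hlam (Fin.rev_le_rev.2 hij)
  have hconj : conjPart (lam ∘ Fin.rev) = conjPart lam := by
    ext i
    exact Finset.card_equiv Fin.revPerm fun k => by simp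
  have h := det_complSymm_eq_det_elemSymm_of_monotone hx (fun k => hL _) n q
  rw [hconj] at h
  rw [← h, ← Matrix.det_submatrix_equiv_self Fin.revPerm]
  congr 1
  ext i j
  have hi := Fin.val_rev i
  have hj := Fin.val_rev j
  simp only [Matrix.submatrix_apply, Matrix.of_apply, Fin.revPerm_apply, Function.comp]
  congr 1
  omega

end Percolation

/-- `W i j`, `i, j ≥ 1`, are independent geometric weights with parameters `q j`, and
`lam 0 ≥ ⋯ ≥ lam (m - 1)` are the parts `λ_1 ≥ ⋯ ≥ λ_m` of a partition. Matrix indices run from `0`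
here, so the row called `i` is the `(i + 1)`-st one. -/
theorem mainTheorem3 {Ω : Type*} [MeasurableSpace Ω] (μ : Measure Ω) [IsProbabilityMeasure μ]
    (q : ℕ → ℝ) (hq : ∀ j : ℕ, 1 ≤ j → 0 < q j ∧ q j < 1)
    (W : ℕ → ℕ → Ω → ℕ)
    (hmeas : ∀ i j : ℕ, 1 ≤ i → 1 ≤ j → Measurable (W i j))
    (hindep : iIndepFun (fun p : ℕ+ × ℕ+ => W p.1 p.2) μ)
    (hgeom : ∀ i j : ℕ, 1 ≤ i → 1 ≤ j → ∀ k : ℕ,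
      μ.real {ω | W i j ω = k} = (1 - q j) * q j ^ k)
    (m n : ℕ) (hm : 1 ≤ m) (hn : 1 ≤ n)
    (lam : Fin m → ℕ) (hlam : Antitone lam) :
    μ.real {ω | ∀ k : Fin m, Percolation.lastPassage (fun i j => W i j ω) (m - k) n = lam k} =
        (∏ j ∈ Finset.Icc 1 n, (1 - q j) ^ m) *
          (Matrix.of fun i j : Fin (lam ⟨0, hm⟩) =>
            Percolation.elemSymm ((Percolation.conjPart lam i : ℤ) - (i : ℕ) + (j : ℕ))
              (Percolation.conjPart lam i - 1) n q).det ∧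
    μ.real {ω | ∀ k : Fin m, Percolation.lastPassage (fun i j => W i j ω) (m - k) n = lam k} =
        (∏ j ∈ Finset.Icc 1 n, (1 - q j) ^ m) *
          (Matrix.of fun i j : Fin m =>
            Percolation.complSymm ((lam i : ℤ) - (i : ℕ) + (j : ℕ)) i n q).det := by
  have h := Percolation.measureReal_lastPassage_eq_det_complSymm hmeas hindep hgeom m n lam hlam
  refine ⟨?_, h⟩
  rw [h, Percolation.det_complSymm_eq_det_elemSymm lam hlam
    (fun k => hlam (show (⟨0, hm⟩ : Fin m) ≤ k from Nat.zero_le _)) n q]
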